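/- Let $H$ be a separable complex Hilbert space and let $\mathcal B_1(H)$ be the Banach space of trace-class operators on $H$ with the trace norm $\|A\|_1=\mathrm{tr}|A|$. Let $\mathcal S\subset\mathcal B_1(H)$ be the state space of positive operators of trace one, with the trace-norm topology. Let $X$ be a topological space with its Borel $\sigma$-algebra, and let $P_w(X)$ be the set of Borel probability measures on $X$ with the weak topology (the coarsest topology for which $\mu\mapsto\int f\,d\mu$ is continuous for every bounded continuous $f:X\to\mathbb R$). Let $\varphi:X\to\mathcal S$, $x\mapsto\rho_x$, be a closed embedding (a homeomorphism onto a closed subset of $\mathcal S$) such that every $\rho_x$ is a pure state, i.e. a rank-one projection $|\psi\rangle\langle\psi|$ with $\|\psi\|=1$. Suppose that the kernel $k(x,y)=\mathrm{tr}(\rho_x\rho_y)$ is characteristic, i.e. that the kernel mean embedding $\mu\mapsto\int_X k(x,\cdot)\,d\mu(x)$ is injective on Borel probability measures on $X$. Then: 1. for every $\mu\in P_w(X)$ the map $\varphi$ is Bochner integrable with respect to $\mu$ as a map into $\mathcal B_1(H)$, so the barycenter $T(\mu)=\int_X\rho_x\,d\mu(x)\in\mathcal B_1(H)$ is well defined;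 2. $T$ is a homeomorphism from $P_w(X)$ onto the $\|\cdot\|_1$-closed convex hull of $\varphi(X)$ in $\mathcal B_1(H)$; 3. the trace distance $d(\mu,\nu)=\tfrac12\|T(\mu)-T(\nu)\|_1$ completely metrizes $P_w(X)$: it is a metric on $P_w(X)$ that induces the weak topology, and $P_w(X)$ is complete with respect to it. -/

import Mathlib

open MeasureTheory Set Topology
open scoped InnerProductSpace ENNReal

noncomputable section

namespace QPM

variable {H : Type*} [NormedAddCommGroup H] [InnerProductSpace ℂ H]

lemma parseval {ι : Type*} (b : HilbertBasis ι ℂ H) (x : H) :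
    ∑' i, ‖⟪b i, x⟫_ℂ‖ₑ ^ 2 = ‖x‖ₑ ^ 2 := by
  have h : HasSum (fun i => ‖⟪b i, x⟫_ℂ‖ ^ 2) (‖x‖ ^ 2) := by
    have h1 := (b.hasSum_inner_mul_inner x x).mapL Complex.reCLM
    have e : ∀ i, Complex.reCLM (⟪x, b i⟫_ℂ * ⟪b i, x⟫_ℂ) = ‖⟪b i, x⟫_ℂ‖ ^ 2 := by
      intro i
      rw [← inner_conj_symm x (b i), Complex.conj_mul']
      simp [← Complex.ofReal_pow]
    simp only [e] at h1
    have e2 : Complex.reCLM ⟪x, x⟫_ℂ = ‖x‖ ^ 2 := by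
      rw [inner_self_eq_norm_sq_to_K]
      simp [← Complex.ofReal_pow]
    rwa [e2] at h1
  have h2 := ENNReal.ofReal_tsum_of_nonneg (fun i => sq_nonneg ‖⟪b i, x⟫_ℂ‖) h.summable
  rw [h.tsum_eq] at h2
  simp only [ENNReal.ofReal_pow (norm_nonneg _), ofReal_norm] at h2
  exact h2.symm

lemma enorm_apply_le {Y : H →L[ℂ] H} (hY : ‖Y‖ ≤ 1) (x : H) : ‖Y x‖ₑ ≤ ‖x‖ₑ := by
  rw [← ofReal_norm, ← ofReal_norm]
  refine ENNReal.ofReal_le_ofReal ?_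
  simpa using Y.le_of_opNorm_le hY x

lemma enorm_inner_le (x y : H) : 2 * ‖⟪x, y⟫_ℂ‖ₑ ≤ ‖x‖ₑ ^ 2 + ‖y‖ₑ ^ 2 := by
  simp only [← ofReal_norm]
  rw [← ENNReal.ofReal_pow (norm_nonneg _), ← ENNReal.ofReal_pow (norm_nonneg _),
    ← ENNReal.ofReal_add (by positivity) (by positivity),
    show (2 : ℝ≥0∞) = ENNReal.ofReal 2 by simp, ← ENNReal.ofReal_mul (by norm_num)]
  refine ENNReal.ofReal_le_ofReal ?_
  have := norm_inner_le_norm (𝕜 := ℂ) x y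
  nlinarith [sq_nonneg (‖x‖ - ‖y‖)]

variable [CompleteSpace H]

/-- `tr |A| = ∑ i, ⟨b i, |A| b i⟩ ∈ [0, ∞]`, where `|A| = √(A⋆A)` and `b` is an orthonormal
(Hilbert) basis of `H`. -/
def eTraceNormWith {ι : Type*} (b : HilbertBasis ι ℂ H) (A : H →L[ℂ] H) : ℝ≥0∞ :=
  ∑' i, ENNReal.ofReal (RCLike.re ⟪b i, CFC.abs A (b i)⟫_ℂ)

variable (H) in
/-- Index set of the orthonormal basis `basis H`. -/
def BasisIndex : Set H := (exists_hilbertBasis ℂ H).choose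

variable (H) in
/-- A chosen orthonormal (Hilbert) basis of `H`. -/
def basis : HilbertBasis (BasisIndex H) ℂ H :=
  (exists_hilbertBasis ℂ H).choose_spec.choose

/-- The trace norm `‖A‖₁ = tr |A|` of a bounded operator, with values in `[0, ∞]`; it does not
depend on the basis, see `eTraceNorm_eq`. -/
def eTraceNorm (A : H →L[ℂ] H) : ℝ≥0∞ := eTraceNormWith (basis H) A

/-- The trace `tr A = ∑ i, ⟨b i, A b i⟩` of an operator (used for trace-class operators, for
which the series converges absolutely, see `summable_trace`). -/
def trace (A : H →L[ℂ] H) : ℂ := ∑' i, ⟪basis H i, A (basis H i)⟫_ℂ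

section Aux

/-- Squared Hilbert-Schmidt norm in the basis `b`. -/
def hs {ι : Type*} (b : HilbertBasis ι ℂ H) (T : H →L[ℂ] H) : ℝ≥0∞ := ∑' i, ‖T (b i)‖ₑ ^ 2

lemma hs_adjoint {ι κ : Type*} (b : HilbertBasis ι ℂ H) (c : HilbertBasis κ ℂ H)
    (T : H →L[ℂ] H) : hs b T = hs c (star T) := by
  unfold hs
  simp_rw [← parseval c (T _), ← parseval b (star T _)]
  rw [ENNReal.tsum_comm]
  refine tsum_congr fun j => tsum_congr fun i => ?_
  rw [ContinuousLinearMap.star_eq_adjoint, ContinuousLinearMap.adjoint_inner_right,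
    ← inner_conj_symm, RCLike.enorm_conj]

lemma hs_mul_le {ι : Type*} (b : HilbertBasis ι ℂ H) (T : H →L[ℂ] H) {Y : H →L[ℂ] H}
    (hY : ‖Y‖ ≤ 1) : hs b (T * Y) ≤ hs b T := by
  rw [hs_adjoint b b, hs_adjoint b b T, star_mul]
  refine ENNReal.tsum_le_tsum fun i => ?_
  gcongr
  exact enorm_apply_le ((norm_star Y).trans_le hY) _

/-- `√|A|`. -/
def rt (A : H →L[ℂ] H) : H →L[ℂ] H := CFC.sqrt (CFC.abs A)

lemma star_rt (A : H →L[ℂ] H) : star (rt A) = rt A :=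
  (IsSelfAdjoint.of_nonneg (CFC.sqrt_nonneg _)).star_eq

lemma rt_mul_rt (A : H →L[ℂ] H) : rt A * rt A = CFC.abs A :=
  CFC.sqrt_mul_sqrt_self _ (CFC.abs_nonneg A)

lemma star_abs (A : H →L[ℂ] H) : star (CFC.abs A) = CFC.abs A :=
  (IsSelfAdjoint.of_nonneg (CFC.abs_nonneg _)).star_eq

lemma inner_star_left (T : H →L[ℂ] H) (x y : H) : ⟪star T x, y⟫_ℂ = ⟪x, T y⟫_ℂ := by
  rw [ContinuousLinearMap.star_eq_adjoint, ContinuousLinearMap.adjoint_inner_left]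

lemma inner_abs (A : H →L[ℂ] H) (x y : H) : ⟪x, CFC.abs A y⟫_ℂ = ⟪rt A x, rt A y⟫_ℂ := by
  rw [← rt_mul_rt, mul_apply_eq_comp, ← inner_star_left, star_rt]

lemma re_inner_abs (A : H →L[ℂ] H) (x : H) :
    RCLike.re ⟪x, CFC.abs A x⟫_ℂ = ‖rt A x‖ ^ 2 := by
  rw [inner_abs, inner_self_eq_norm_sq]

lemma eTraceNormWith_eq_hs {ι : Type*} (b : HilbertBasis ι ℂ H) (A : H →L[ℂ] H) :
    eTraceNormWith b A = hs b (rt A) := by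
  unfold eTraceNormWith hs
  refine tsum_congr fun i => ?_
  rw [re_inner_abs, ENNReal.ofReal_pow (norm_nonneg _), ofReal_norm]

/-- Approximate polar decomposition. -/
lemma exists_polar (A : H →L[ℂ] H) {ε : ℝ} (hε : 0 < ε) : ∃ W : H →L[ℂ] H, ‖W‖ ≤ 1 ∧
    A = W * CFC.abs A + (ε : ℂ) • W ∧ ‖CFC.abs A - star W * A‖ ≤ ε := by
  set P := CFC.abs A with hP
  have hP0 : 0 ≤ P := CFC.abs_nonneg A
  have hsP : star P = P := star_abs A
  have hPP : P * P = star A * A := CFC.abs_mul_abs A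
  have hn : ∀ x, ‖A x‖ = ‖P x‖ := by
    intro x
    have h1 : ⟪A x, A x⟫_ℂ = ⟪P x, P x⟫_ℂ := by
      rw [← inner_star_left, ← mul_apply_eq_comp, ← hPP,
        mul_apply_eq_comp, ← inner_star_left, hsP]
    have h2 := congrArg RCLike.re h1
    rw [inner_self_eq_norm_sq, inner_self_eq_norm_sq] at h2
    exact (sq_eq_sq₀ (norm_nonneg _) (norm_nonneg _)).1 h2
  set S : H →L[ℂ] H := P + (ε : ℂ) • 1 with hS
  have hSx : ∀ x, ‖S x‖ ^ 2 = ‖P x‖ ^ 2 + 2 * ε * ‖rt A x‖ ^ 2 + ε ^ 2 * ‖x‖ ^ 2 := by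
    intro x
    have e : S x = P x + (ε : ℂ) • x := by simp [hS]
    rw [e, @norm_add_sq ℂ, inner_smul_right, norm_smul]
    have : RCLike.re ((ε : ℂ) * ⟪P x, x⟫_ℂ) = ε * ‖rt A x‖ ^ 2 := by
      rw [← re_inner_abs, ← hP, ← inner_star_left, hsP]
      simp
    rw [this]
    simp [abs_of_pos hε]
    ring
  have hSu : IsUnit S := by
    have : IsUnit (algebraMap ℝ (H →L[ℂ] H) ε + P) := by
      have h1 : IsStrictlyPositive (algebraMap ℝ (H →L[ℂ] H) ε + P) := by
        refine IsStrictlyPositive.add_nonneg ?_ hP0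
        exact isStrictlyPositive_algebraMap hε
      exact h1.isUnit
    convert this using 1
    rw [hS, add_comm, Algebra.algebraMap_eq_smul_one]
    simp
  obtain ⟨u, hu⟩ := hSu
  set R : H →L[ℂ] H := ↑u⁻¹ with hR
  have hSR : S * R = 1 := by rw [← hu, hR]; simp
  have hRS : R * S = 1 := by rw [← hu, hR]; simp
  have hsS : star S = S := by simp [hS, hsP]
  have hsR : star R = R := by
    have h1 : star R * S = 1 := by
      rw [← hsS, ← star_mul, hSR, star_one]
    calc star R = star R * (S * R) := by rw [hSR, mul_one]
      _ = R := by rw [← mul_assoc, h1, one_mul]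
  have key : ∀ y, ‖P (R y)‖ ≤ ‖y‖ ∧ ‖A (R y)‖ ≤ ‖y‖ := by
    intro y
    have h1 : S (R y) = y := by
      rw [← mul_apply_eq_comp, hSR]; rfl
    have h2 := hSx (R y)
    rw [h1] at h2
    have h3 : ‖P (R y)‖ ≤ ‖y‖ := by
      refine (sq_le_sq₀ (norm_nonneg _) (norm_nonneg _)).1 ?_
      rw [h2]
      have : 0 ≤ 2 * ε * ‖rt A (R y)‖ ^ 2 + ε ^ 2 * ‖R y‖ ^ 2 := by positivity
      linarith
    exact ⟨h3, by rw [hn]; exact h3⟩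
  refine ⟨A * R, ?_, ?_, ?_⟩
  · refine ContinuousLinearMap.opNorm_le_bound _ zero_le_one fun y => ?_
    simpa using (key y).2
  · have : A * R * S = A * R * P + (ε : ℂ) • (A * R) := by
      rw [hS, mul_add, mul_smul_comm, mul_one]
    rw [← this, mul_assoc, hRS, mul_one]
  · have hPS : P = star (A * R) * A + (ε : ℂ) • (R * P) := by
      rw [star_mul, hsR, mul_assoc, ← hPP, ← mul_smul_comm, ← mul_add]
      have : P * P + (ε : ℂ) • P = S * P := by rw [hS, add_mul, smul_mul_assoc, one_mul]
      rw [this, ← mul_assoc, hRS, one_mul]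
    have hRP : R * P = star (P * R) := by rw [star_mul, hsP, hsR]
    have hb : ‖R * P‖ ≤ 1 := by
      rw [hRP, norm_star]
      refine ContinuousLinearMap.opNorm_le_bound _ zero_le_one fun y => ?_
      simpa using (key y).1
    have : P - star (A * R) * A = (ε : ℂ) • (R * P) := by
      nth_rewrite 1 [hPS]
      simp
    rw [this, norm_smul]
    have : ‖(ε : ℂ)‖ = ε := by simp [abs_of_pos hε]
    rw [this]
    nlinarith

lemma sum_inner_le {ι κ : Type*} (b : HilbertBasis ι ℂ H) (c : HilbertBasis κ ℂ H)
    (A X : H →L[ℂ] H) (hX : ‖X‖ ≤ 1) (F : Finset ι) :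
    ∑ i ∈ F, ‖⟪X (b i), A (b i)⟫_ℂ‖ₑ ≤ eTraceNormWith c A := by
  have hc : eTraceNormWith c A = hs b (rt A) := by
    rw [eTraceNormWith_eq_hs, hs_adjoint c b, star_rt]
  rw [hc]
  refine ENNReal.le_of_forall_pos_le_add fun δ hδ _ => ?_
  set ε : ℝ := δ / (F.card + 1) with hε
  have hε0 : 0 < ε := by positivity
  obtain ⟨W, hW, hA, -⟩ := exists_polar A hε0
  have hY : ‖star W * X‖ ≤ 1 :=
    (norm_mul_le _ _).trans (mul_le_one₀ (by rwa [norm_star]) (norm_nonneg _) hX)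
  have h1 : ∀ i, ‖⟪X (b i), A (b i)⟫_ℂ‖ₑ ≤
      (‖(rt A * (star W * X)) (b i)‖ₑ ^ 2 + ‖rt A (b i)‖ₑ ^ 2) / 2 + ENNReal.ofReal ε := by
    intro i
    have e : ⟪X (b i), A (b i)⟫_ℂ = ⟪(rt A * (star W * X)) (b i), rt A (b i)⟫_ℂ
        + (ε : ℂ) * ⟪X (b i), W (b i)⟫_ℂ := by
      nth_rewrite 1 [hA]
      simp only [add_apply, mul_apply_eq_comp,
        smul_apply, inner_add_right, inner_smul_right]
      rw [← inner_abs, inner_star_left]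
    rw [e]
    refine (enorm_add_le _ _).trans (add_le_add ?_ ?_)
    · rw [ENNReal.le_div_iff_mul_le (by simp) (by simp), mul_comm]
      exact enorm_inner_le _ _
    · rw [← ofReal_norm]
      refine ENNReal.ofReal_le_ofReal ?_
      rw [norm_mul]
      have hb : ‖b i‖ = 1 := b.orthonormal.1 i
      have h2 : ‖⟪X (b i), W (b i)⟫_ℂ‖ ≤ 1 := by
        refine (norm_inner_le_norm _ _).trans (mul_le_one₀ ?_ (norm_nonneg _) ?_)
        · simpa [hb] using X.le_of_opNorm_le hX (b i)
        · simpa [hb] using W.le_of_opNorm_le hW (b i)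
      have : ‖(ε : ℂ)‖ = ε := by simp [abs_of_pos hε0]
      rw [this]
      nlinarith
  calc ∑ i ∈ F, ‖⟪X (b i), A (b i)⟫_ℂ‖ₑ
      ≤ ∑ i ∈ F, ((‖(rt A * (star W * X)) (b i)‖ₑ ^ 2 + ‖rt A (b i)‖ₑ ^ 2) / 2
          + ENNReal.ofReal ε) := Finset.sum_le_sum fun i _ => h1 i
    _ = (∑ i ∈ F, ‖(rt A * (star W * X)) (b i)‖ₑ ^ 2 + ∑ i ∈ F, ‖rt A (b i)‖ₑ ^ 2) / 2
          + F.card * ENNReal.ofReal ε := by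
        simp only [Finset.sum_add_distrib, div_eq_mul_inv, ← Finset.sum_mul]
        simp
    _ ≤ (hs b (rt A * (star W * X)) + hs b (rt A)) / 2 + δ := by
        gcongr
        · exact ENNReal.sum_le_tsum F
        · exact ENNReal.sum_le_tsum F
        · rw [← ENNReal.ofReal_natCast, ← ENNReal.ofReal_mul (Nat.cast_nonneg _),
            ← ENNReal.ofReal_coe_nnreal]
          refine ENNReal.ofReal_le_ofReal ?_
          rw [hε, ← mul_div_assoc, div_le_iff₀ (Nat.cast_add_one_pos _)]
          nlinarith [δ.coe_nonneg]
    _ ≤ (hs b (rt A) + hs b (rt A)) / 2 + δ :=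
        add_le_add_left (ENNReal.div_le_div_right (add_le_add_left (hs_mul_le b _ hY) _) _) _
    _ = hs b (rt A) + δ := by rw [ENNReal.add_div, ENNReal.add_halves]

lemma eTraceNormWith_le {ι : Type*} (b : HilbertBasis ι ℂ H) (A : H →L[ℂ] H) (c : ℝ≥0∞)
    (h : ∀ (X : H →L[ℂ] H), ‖X‖ ≤ 1 → ∀ F : Finset ι,
      ∑ i ∈ F, ‖⟪X (b i), A (b i)⟫_ℂ‖ₑ ≤ c) : eTraceNormWith b A ≤ c := by
  unfold eTraceNormWith
  rw [ENNReal.tsum_eq_iSup_sum]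
  refine iSup_le fun F => ?_
  refine ENNReal.le_of_forall_pos_le_add fun δ hδ _ => ?_
  set ε : ℝ := δ / (F.card + 1) with hε
  have hε0 : 0 < ε := by positivity
  obtain ⟨W, hW, -, hA⟩ := exists_polar A hε0
  have h1 : ∀ i, ENNReal.ofReal (RCLike.re ⟪b i, CFC.abs A (b i)⟫_ℂ) ≤
      ‖⟪W (b i), A (b i)⟫_ℂ‖ₑ + ENNReal.ofReal ε := by
    intro i
    rw [← ofReal_norm, ← ENNReal.ofReal_add (norm_nonneg _) hε0.le]
    refine ENNReal.ofReal_le_ofReal ?_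
    have e : ⟪b i, CFC.abs A (b i)⟫_ℂ = ⟪W (b i), A (b i)⟫_ℂ
        + ⟪b i, (CFC.abs A - star W * A) (b i)⟫_ℂ := by
      rw [← star_star W, inner_star_left, star_star, ← inner_add_right]
      simp
    rw [e]
    refine (RCLike.re_le_norm _).trans ((norm_add_le _ _).trans ?_)
    gcongr
    have hb : ‖b i‖ = 1 := b.orthonormal.1 i
    refine (norm_inner_le_norm _ _).trans ?_
    simpa [hb] using ContinuousLinearMap.le_of_opNorm_le _ hA (b i)
  calc _ ≤ ∑ i ∈ F, (‖⟪W (b i), A (b i)⟫_ℂ‖ₑ + ENNReal.ofReal ε) :=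
        Finset.sum_le_sum fun i _ => h1 i
    _ = ∑ i ∈ F, ‖⟪W (b i), A (b i)⟫_ℂ‖ₑ + F.card * ENNReal.ofReal ε := by
        simp [Finset.sum_add_distrib]
    _ ≤ c + δ := by
        gcongr
        · exact h W hW F
        · rw [← ENNReal.ofReal_natCast, ← ENNReal.ofReal_mul (Nat.cast_nonneg _),
            ← ENNReal.ofReal_coe_nnreal]
          refine ENNReal.ofReal_le_ofReal ?_
          rw [hε, ← mul_div_assoc, div_le_iff₀ (Nat.cast_add_one_pos _)]
          nlinarith [δ.coe_nonneg]

/-- The trace norm does not depend on the orthonormal basis. -/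
lemma eTraceNorm_eq {ι : Type*} (b : HilbertBasis ι ℂ H) (A : H →L[ℂ] H) :
    eTraceNorm A = eTraceNormWith b A :=
  le_antisymm (eTraceNormWith_le _ _ _ fun X hX F => sum_inner_le _ b A X hX F)
    (eTraceNormWith_le _ _ _ fun X hX F => sum_inner_le b _ A X hX F)

lemma eTraceNorm_zero : eTraceNorm (0 : H →L[ℂ] H) = 0 :=
  le_antisymm (eTraceNormWith_le _ _ _ fun X _ F => by simp) (zero_le)

lemma eTraceNorm_add_le (A B : H →L[ℂ] H) :
    eTraceNorm (A + B) ≤ eTraceNorm A + eTraceNorm B := by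
  refine eTraceNormWith_le _ _ _ fun X hX F => ?_
  refine le_trans ?_ (add_le_add (sum_inner_le (basis H) _ A X hX F)
    (sum_inner_le (basis H) _ B X hX F))
  rw [← Finset.sum_add_distrib]
  refine Finset.sum_le_sum fun i _ => ?_
  rw [add_apply, inner_add_right]
  exact enorm_add_le _ _

lemma eTraceNorm_smul_le (z : ℂ) (A : H →L[ℂ] H) :
    eTraceNorm (z • A) ≤ ‖z‖ₑ * eTraceNorm A := by
  refine eTraceNormWith_le _ _ _ fun X hX F => ?_
  refine le_trans (le_of_eq ?_) (mul_le_mul_right (sum_inner_le (basis H) _ A X hX F) _)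
  rw [Finset.mul_sum]
  refine Finset.sum_congr rfl fun i _ => ?_
  rw [smul_apply, inner_smul_right, enorm_mul]

lemma eTraceNorm_neg (A : H →L[ℂ] H) : eTraceNorm (-A) = eTraceNorm A := by
  unfold eTraceNorm eTraceNormWith
  rw [CFC.abs_neg]

lemma enorm_le_eTraceNorm (A : H →L[ℂ] H) : ‖A‖ₑ ≤ eTraceNorm A := by
  have h1 : ∀ x, ‖rt A x‖ₑ ^ 2 ≤ eTraceNorm A * ‖x‖ₑ ^ 2 := by
    intro x
    rw [← parseval (basis H) (rt A x), eTraceNorm, eTraceNormWith_eq_hs, hs,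
      ← ENNReal.tsum_mul_right]
    refine ENNReal.tsum_le_tsum fun i => ?_
    rw [← inner_star_left, star_rt, ← mul_pow]
    gcongr
    simp only [← ofReal_norm]
    rw [← ENNReal.ofReal_mul (norm_nonneg _)]
    exact ENNReal.ofReal_le_ofReal (norm_inner_le_norm _ _)
  by_cases ht : eTraceNorm A = ∞
  · simp [ht]
  have h2 : ‖rt A‖ ≤ √(eTraceNorm A).toReal := by
    refine ContinuousLinearMap.opNorm_le_bound _ (Real.sqrt_nonneg _) fun x => ?_
    refine (sq_le_sq₀ (norm_nonneg _) (by positivity)).1 ?_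
    rw [mul_pow, Real.sq_sqrt ENNReal.toReal_nonneg]
    have := ENNReal.toReal_mono (by finiteness) (h1 x)
    simpa using this
  have h3 : ‖A‖ = ‖rt A‖ ^ 2 := by
    rw [← CFC.norm_abs (a := A), ← rt_mul_rt, sq]
    nth_rewrite 1 [← star_rt A]
    exact CStarRing.norm_star_mul_self
  rw [← ofReal_norm, ENNReal.ofReal_le_iff_le_toReal ht, h3]
  calc ‖rt A‖ ^ 2 ≤ √(eTraceNorm A).toReal ^ 2 := by gcongr
    _ = _ := Real.sq_sqrt ENNReal.toReal_nonneg

lemma eTraceNorm_le_of_tendsto {α : Type*} {l : Filter α} [l.NeBot] {u : α → (H →L[ℂ] H)}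
    {A : H →L[ℂ] H} (hu : Filter.Tendsto u l (𝓝 A)) {c : ℝ≥0∞}
    (hc : ∀ᶠ n in l, eTraceNorm (u n) ≤ c) : eTraceNorm A ≤ c := by
  refine eTraceNormWith_le _ _ _ fun X hX F => ?_
  have h1 : Filter.Tendsto (fun n => ∑ i ∈ F, ‖⟪X (basis H i), u n (basis H i)⟫_ℂ‖ₑ) l
      (𝓝 (∑ i ∈ F, ‖⟪X (basis H i), A (basis H i)⟫_ℂ‖ₑ)) := by
    refine tendsto_finsetSum _ fun i _ => ?_
    have h2 : Continuous fun T : H →L[ℂ] H => ‖⟪X (basis H i), T (basis H i)⟫_ℂ‖ₑ := by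
      fun_prop
    exact (h2.tendsto A).comp hu
  refine le_of_tendsto h1 ?_
  filter_upwards [hc] with n hn
  exact (sum_inner_le (basis H) _ (u n) X hX F).trans hn

/-- The series defining the trace of a trace-class operator converges absolutely. -/
lemma summable_trace {ι : Type*} (b : HilbertBasis ι ℂ H) {A : H →L[ℂ] H}
    (hA : eTraceNorm A < ∞) : Summable fun i => ⟪b i, A (b i)⟫_ℂ := by
  have h : ∑' i, ‖⟪b i, A (b i)⟫_ℂ‖ₑ ≤ eTraceNorm A := by
    rw [ENNReal.tsum_eq_iSup_sum]
    refine iSup_le fun F => ?_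
    refine sum_inner_le b (basis H) A 1 ?_ F
    exact ContinuousLinearMap.opNorm_le_bound _ zero_le_one fun x => by simp
  refine Summable.of_nnnorm ?_
  rw [← ENNReal.tsum_coe_ne_top_iff_summable]
  exact (h.trans_lt hA).ne

end Aux

variable (H) in
/-- The subspace of trace-class operators, `tr |A| < ∞`. -/
def traceClassSubmodule : Submodule ℂ (H →L[ℂ] H) where
  carrier := {A | eTraceNorm A < ∞}
  add_mem' hA hB := (eTraceNorm_add_le _ _).trans_lt (ENNReal.add_lt_top.2 ⟨hA, hB⟩)
  zero_mem' := by simp [eTraceNorm_zero]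
  smul_mem' z _ hA := (eTraceNorm_smul_le z _).trans_lt (ENNReal.mul_lt_top (by simp) hA)

variable (H) in
/-- The space `𝓑₁(H)` of trace-class operators on `H` (with the trace norm below, not the
operator norm). -/
def TraceClass : Type _ := traceClassSubmodule H

namespace TraceClass

/-- The underlying bounded operator. -/
def op (A : TraceClass H) : H →L[ℂ] H := Subtype.val A

instance : AddCommGroup (TraceClass H) := inferInstanceAs (AddCommGroup (traceClassSubmodule H))

instance : Module ℂ (TraceClass H) := inferInstanceAs (Module ℂ (traceClassSubmodule H))

lemma op_injective : Function.Injective (op : TraceClass H → H →L[ℂ] H) :=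
  Subtype.val_injective

lemma eTraceNorm_lt_top (A : TraceClass H) : eTraceNorm A.op < ∞ := Subtype.property A

@[simp] lemma op_zero : (0 : TraceClass H).op = 0 := rfl
@[simp] lemma op_add (A B : TraceClass H) : (A + B).op = A.op + B.op := rfl
@[simp] lemma op_sub (A B : TraceClass H) : (A - B).op = A.op - B.op := rfl
@[simp] lemma op_neg (A : TraceClass H) : (-A).op = -A.op := rfl
@[simp] lemma op_smul (z : ℂ) (A : TraceClass H) : (z • A).op = z • A.op := rfl

/-- The trace norm `‖A‖₁ = tr |A|`. -/
instance : Norm (TraceClass H) := ⟨fun A => (eTraceNorm A.op).toReal⟩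

lemma norm_def (A : TraceClass H) : ‖A‖ = (eTraceNorm A.op).toReal := rfl

lemma opNorm_le (A : TraceClass H) : ‖A.op‖ ≤ ‖A‖ := by
  have := ENNReal.toReal_mono A.eTraceNorm_lt_top.ne (enorm_le_eTraceNorm A.op)
  rw [norm_def]
  simpa using this

instance : NormedAddCommGroup (TraceClass H) :=
  AddGroupNorm.toNormedAddCommGroup
    { toFun := fun A => ‖A‖
      map_zero' := by simp [norm_def, eTraceNorm_zero]
      add_le' := fun A B => by
        rw [norm_def, norm_def, norm_def,
          ← ENNReal.toReal_add A.eTraceNorm_lt_top.ne B.eTraceNorm_lt_top.ne]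
        exact ENNReal.toReal_mono
          (ENNReal.add_lt_top.2 ⟨A.eTraceNorm_lt_top, B.eTraceNorm_lt_top⟩).ne
          (eTraceNorm_add_le _ _)
      neg' := fun A => by rw [norm_def, norm_def, op_neg, eTraceNorm_neg]
      eq_zero_of_map_eq_zero' := fun A h => by
        have h1 := A.opNorm_le
        rw [h] at h1
        exact op_injective (norm_le_zero_iff.1 h1) }

instance : NormedSpace ℂ (TraceClass H) where
  norm_smul_le z A := by
    rw [norm_def, norm_def, op_smul, ← toReal_enorm z, ← ENNReal.toReal_mul]
    exact ENNReal.toReal_mono (ENNReal.mul_lt_top (by simp) A.eTraceNorm_lt_top).ne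
      (eTraceNorm_smul_le _ _)

/-- `𝓑₁(H)` is a Banach space. -/
instance : CompleteSpace (TraceClass H) := by
  refine Metric.complete_of_cauchySeq_tendsto fun u hu => ?_
  have h1 : CauchySeq fun n => (u n).op := by
    rw [Metric.cauchySeq_iff] at hu ⊢
    intro ε hε
    obtain ⟨N, hN⟩ := hu ε hε
    refine ⟨N, fun m hm n hn => lt_of_le_of_lt ?_ (hN m hm n hn)⟩
    rw [dist_eq_norm, dist_eq_norm, ← op_sub]
    exact opNorm_le _
  obtain ⟨A, hA⟩ := cauchySeq_tendsto_of_complete h1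
  have h2 : ∀ ε : ℝ, 0 < ε → ∃ N, ∀ m ≥ N, eTraceNorm ((u m).op - A) ≤ ENNReal.ofReal ε := by
    intro ε hε
    obtain ⟨N, hN⟩ := Metric.cauchySeq_iff.1 hu ε hε
    refine ⟨N, fun m hm => ?_⟩
    refine eTraceNorm_le_of_tendsto (tendsto_const_nhds.sub hA) (l := Filter.atTop) ?_
    filter_upwards [Filter.eventually_ge_atTop N] with n hn
    have h3 := (hN m hm n hn).le
    rw [dist_eq_norm, norm_def, op_sub] at h3
    rw [← op_sub] at h3 ⊢
    exact (ENNReal.le_ofReal_iff_toReal_le (eTraceNorm_lt_top _).ne hε.le).2 h3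
  obtain ⟨N, hN⟩ := h2 1 one_pos
  have hAt : eTraceNorm A < ∞ := by
    have e : A = (u N).op + -((u N).op - A) := by abel
    rw [e]
    refine (eTraceNorm_add_le _ _).trans_lt (ENNReal.add_lt_top.2
      ⟨eTraceNorm_lt_top _, ?_⟩)
    rw [eTraceNorm_neg]
    exact (hN N le_rfl).trans_lt (by simp)
  let A' : TraceClass H := ⟨A, hAt⟩
  refine ⟨A', Metric.tendsto_atTop'.2 fun ε hε => ?_⟩
  obtain ⟨M, hM⟩ := h2 (ε / 2) (by positivity)
  refine ⟨M, fun n hn => ?_⟩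
  rw [dist_eq_norm, norm_def, op_sub]
  have h4 : (eTraceNorm ((u n).op - A)).toReal ≤ ε / 2 :=
    ENNReal.toReal_le_of_le_ofReal (by positivity) (hM n hn.le)
  exact lt_of_le_of_lt h4 (by linarith)

end TraceClass

variable (H) in
/-- The quantum state space: positive trace-class operators of trace one, with the topology of
the trace norm. -/
def stateSpace : Set (TraceClass H) := {A | A.op.IsPositive ∧ trace A.op = 1}

/-- Pure states: the rank-one projections `|ψ⟩⟨ψ|` with `‖ψ‖ = 1`. -/
def IsPure (A : TraceClass H) : Prop :=
  ∃ ψ : H, ‖ψ‖ = 1 ∧ A.op = InnerProductSpace.rankOne ℂ ψ ψ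

/-- The trace distance `½ tr |A - B|`. -/
def traceDist (A B : TraceClass H) : ℝ := 1 / 2 * ‖A - B‖

/-- The kernel `k(x, y) = tr (φ(x) φ(y))`. -/
def kernel {X : Type*} (φ : X → stateSpace H) (x y : X) : ℂ :=
  trace ((φ x).1.op * (φ y).1.op)

/-- A kernel `k` is characteristic if a probability measure `μ` is determined by its kernel mean
embedding, the function `y ↦ ∫ k(x, y) dμ(x)`. -/
def IsCharacteristic {X : Type*} [MeasurableSpace X] (k : X → X → ℂ) : Prop :=
  Function.Injective fun (μ : ProbabilityMeasure X) (y : X) => ∫ x, k x y ∂(μ : Measure X)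

/-- The barycenter map `T(μ) = ∫ φ(x) dμ(x)`, a Bochner integral in `𝓑₁(H)`. -/
def barycenter {X : Type*} [MeasurableSpace X] (φ : X → stateSpace H)
    (μ : ProbabilityMeasure X) : TraceClass H :=
  ∫ x, (φ x : TraceClass H) ∂(μ : Measure X)

/-- `d` completely metrizes the topological space `P`: it is a complete metric that induces the
topology of `P`. -/
def CompletelyMetrizes {P : Type*} [t : TopologicalSpace P] (d : P → P → ℝ) : Prop :=
  ∃ m : MetricSpace P, (∀ p q, m.dist p q = d p q) ∧
    m.toUniformSpace.toTopologicalSpace = t ∧ @CompleteSpace P m.toUniformSpace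

end QPM

end

/-! The barycenter map `T` is a closed embedding of the weak space of probability measures into the
Banach space of trace-class operators: it is continuous, injective and proper.

Continuity: pure states have trace norm at most one and form a separable set, since they are a
continuous image of `H`. For a bounded continuous function with separable range, Bochner integrals
depend norm-continuously on the measure (`continuous_integral_of_isSeparable_range`).

Injectivity: if `ρ_y = |ψ⟩⟨ψ|`, the kernel mean embedding at `y` is `⟨ψ, T(μ) ψ⟩`, so `T(μ)`
determines the embedding and hence `μ`.

Properness: on a compact set of operators the tails of the trace are uniformly small. For `|ψ⟩⟨ψ|`
the tail is the squared distance from `ψ` to a finite-dimensional subspace, so by Markov's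
inequality the measures with barycenter in the compact set are tight
(`isTightMeasureSet_of_integral_mem_isCompact`). Prokhorov's theorem gives compact preimages.

The range of `T` is then closed and convex and contains every `ρ_x` as the barycenter of a Dirac
mass, so it is the closed convex hull. Pulling back half the trace norm gives a complete metric. -/

/-! ### Norm continuity of Bochner integrals in the weak topology -/

open Filter in
/-- Weak convergence of probability measures implies convergence of the Bochner integrals of a
bounded continuous function with separable range. -/
theorem continuous_integral_of_isSeparable_range {X E : Type*} [TopologicalSpace X]
    [MeasurableSpace X] [OpensMeasurableSpace X] [NormedAddCommGroup E] [NormedSpace ℝ E]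
    [CompleteSpace E]
    {f : X → E} (hf : Continuous f) (hsep : TopologicalSpace.IsSeparable (range f)) {C : ℝ}
    (hC : ∀ x, ‖f x‖ ≤ C)
    (hint : ∀ μ : ProbabilityMeasure X, Integrable f (μ : Measure X)) :
    Continuous fun μ : ProbabilityMeasure X => ∫ x, f x ∂(μ : Measure X) := by
  rcases isEmpty_or_nonempty X with hX | ⟨⟨x₀⟩⟩
  · simp only [integral_of_isEmpty]
    exact continuous_const
  have hC0 : 0 ≤ C := (norm_nonneg _).trans (hC x₀)
  obtain ⟨c, hc, hcd⟩ := hsep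
  have hcne : c.Nonempty := by
    rw [nonempty_iff_ne_empty]
    rintro rfl
    simpa using hcd (mem_range_self x₀)
  obtain ⟨e, rfl⟩ := hc.exists_eq_range hcne
  rw [continuous_iff_continuousAt]
  intro μ
  refine continuousAt_of_locally_uniform_approx_of_continuousAt fun u hu => ?_
  obtain ⟨δ, hδ, hδu⟩ := Metric.mem_uniformity_dist.1 hu
  -- The error below is at most `(1 + C) * ε`; the 2 makes the final inequality strict.
  set ε : ℝ := δ / (2 + C) with hε
  have hε0 : 0 < ε := by positivity
  -- Bumps supported where `f` is `ε`-close to `e i`; normalized, they form an approximate partition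
  -- of unity.
  let h : ℕ → X → ℝ := fun i x => max 0 (ε - ‖f x - e i‖)
  have hh0 : ∀ i x, 0 ≤ h i x := fun i x => le_max_left _ _
  have hhc : ∀ i, Continuous (h i) := fun i => by fun_prop
  let s : ℕ → X → ℝ := fun n x => ∑ i ∈ Finset.range n, h i x
  have hs0 : ∀ n x, 0 ≤ s n x := fun n x => Finset.sum_nonneg fun i _ => hh0 i x
  -- Adding `1 / (n + 1)` keeps the denominators positive where all bumps vanish; the weights then
  -- sum to `1 - r n` instead of 1.
  have hη : ∀ n : ℕ, (0 : ℝ) < 1 / ((n : ℝ) + 1) := fun n => by positivity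
  have hsn : ∀ n x, 0 < s n x + 1 / ((n : ℝ) + 1) :=
    fun n x => add_pos_of_nonneg_of_pos (hs0 n x) (hη n)
  let w : ℕ → ℕ → X → ℝ := fun n i x => h i x / (s n x + 1 / ((n : ℝ) + 1))
  have hw0 : ∀ n i x, 0 ≤ w n i x := fun n i x => div_nonneg (hh0 i x) (hsn n x).le
  have hsc : ∀ n, Continuous (s n) := fun n => continuous_finsetSum _ fun i _ => hhc i
  have hwc : ∀ n i, Continuous (w n i) := fun n i =>
    (hhc i).div ((hsc n).add continuous_const) fun x => (hsn n x).ne'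
  let r : ℕ → X → ℝ := fun n x => 1 - ∑ i ∈ Finset.range n, w n i x
  have hr : ∀ n x, r n x = (1 / ((n : ℝ) + 1)) / (s n x + 1 / ((n : ℝ) + 1)) := by
    intro n x
    have := (hsn n x).ne'
    simp only [r, w, ← Finset.sum_div]
    rw [eq_div_iff this, sub_mul, div_mul_cancel₀ _ this]
    simp [s]
  have hr0 : ∀ n x, 0 ≤ r n x := fun n x => by
    rw [hr]; exact div_nonneg (hη n).le (hsn n x).le
  have hr1 : ∀ n x, r n x ≤ 1 := fun n x => by
    have : 0 ≤ ∑ i ∈ Finset.range n, w n i x := Finset.sum_nonneg fun i _ => hw0 n i x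
    simp only [r]; linarith
  have hrc : ∀ n, Continuous (r n) := fun n =>
    continuous_const.sub (continuous_finsetSum _ fun i _ => hwc n i)
  have hw1 : ∀ n, ∀ i ∈ Finset.range n, ∀ x, w n i x ≤ 1 := fun n i hi x => by
    have h1 := Finset.single_le_sum (fun j _ => hw0 n j x) hi
    have := hr0 n x
    simp only [r] at this
    linarith
  have hbi : ∀ g : X → ℝ, Continuous g → (∀ x, 0 ≤ g x) → (∀ x, g x ≤ 1) →
      Continuous fun ν : ProbabilityMeasure X => ∫ x, g x ∂(ν : Measure X) := by
    intro g hg hg0 hg1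
    exact ProbabilityMeasure.continuous_integral_boundedContinuousFunction
      (BoundedContinuousFunction.ofNormedAddCommGroup g hg 1 fun x => by
        rw [Real.norm_of_nonneg (hg0 x)]; exact hg1 x)
  have hii : ∀ g : X → ℝ, Continuous g → (∀ x, 0 ≤ g x) → (∀ x, g x ≤ 1) →
      ∀ ν : ProbabilityMeasure X, Integrable g (ν : Measure X) := by
    intro g hg hg0 hg1 ν
    refine Integrable.of_bound hg.measurable.aestronglyMeasurable 1 (ae_of_all _ fun x => ?_)
    rw [Real.norm_of_nonneg (hg0 x)]; exact hg1 x
  -- By density some bump is positive at each point, so the deficit tends to zero pointwise, and in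
  -- mean for the fixed `μ`.
  have hlim : Tendsto (fun n => ∫ x, r n x ∂(μ : Measure X)) atTop (𝓝 0) := by
    have : Tendsto (fun n => ∫ x, r n x ∂(μ : Measure X)) atTop
        (𝓝 (∫ _, (0 : ℝ) ∂(μ : Measure X))) := by
      refine tendsto_integral_of_dominated_convergence (fun _ => 1)
        (fun n => (hrc n).measurable.aestronglyMeasurable) (integrable_const _)
        (fun n => ae_of_all _ fun x => ?_) (ae_of_all _ fun x => ?_)
      · rw [Real.norm_of_nonneg (hr0 n x)]; exact hr1 n x
      · obtain ⟨_, ⟨i, rfl⟩, hi⟩ := Metric.mem_closure_iff.1 (hcd (mem_range_self x)) ε hε0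
        rw [dist_eq_norm] at hi
        have hpos : 0 < h i x := lt_max_of_lt_right (by linarith)
        have hz : Tendsto (fun n : ℕ => (1 / ((n : ℝ) + 1)) / h i x) atTop (𝓝 0) := by
          simpa using (tendsto_one_div_add_atTop_nhds_zero_nat (𝕜 := ℝ)).div_const (h i x)
        refine tendsto_of_tendsto_of_tendsto_of_le_of_le' tendsto_const_nhds hz
          (Eventually.of_forall fun n => hr0 n x) ?_
        filter_upwards [eventually_gt_atTop i] with n hn
        have h1 : h i x ≤ s n x :=
          Finset.single_le_sum (fun j _ => hh0 j x) (Finset.mem_range.2 hn)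
        rw [hr]
        have := hη n
        gcongr
        linarith
    simpa using this
  obtain ⟨n, hn⟩ := (hlim.eventually_lt_const hε0).exists
  -- Since `r n` is bounded and continuous, a small mean deficit is a weakly open condition: one `n`
  -- serves all `ν` near `μ`, and no tightness is needed.
  refine ⟨{ν | ∫ x, r n x ∂(ν : Measure X) < ε},
    (hbi _ (hrc n) (hr0 n) (hr1 n)).continuousAt.eventually_lt_const hn,
    fun ν => ∑ i ∈ Finset.range n, (∫ x, w n i x ∂(ν : Measure X)) • e i, ?_, fun ν hν => ?_⟩
  · exact (continuous_finsetSum _ fun i hi =>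
      (hbi _ (hwc n i) (hw0 n i) (hw1 n i hi)).smul continuous_const).continuousAt
  · refine hδu ?_
    have hwi : ∀ i ∈ Finset.range n, Integrable (fun x => w n i x • e i) (ν : Measure X) :=
      fun i hi => (hii _ (hwc n i) (hw0 n i) (hw1 n i hi) ν).smul_const _
    have heq : ∫ x, f x ∂(ν : Measure X) -
        ∑ i ∈ Finset.range n, (∫ x, w n i x ∂(ν : Measure X)) • e i =
        ∫ x, (f x - ∑ i ∈ Finset.range n, w n i x • e i) ∂(ν : Measure X) := by
      rw [integral_sub (hint ν) (integrable_finsetSum _ hwi), integral_finsetSum _ hwi]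
      exact congrArg _ (Finset.sum_congr rfl fun i _ => (integral_smul_const _ _).symm)
    rw [dist_eq_norm, heq]
    have hpt : ∀ x, ‖f x - ∑ i ∈ Finset.range n, w n i x • e i‖ ≤ ε + C * r n x := by
      intro x
      -- A weight is nonzero only where `f x` is within `ε` of `e i`; the uncovered mass `r n x`
      -- costs at most `C`.
      have e1 : f x - ∑ i ∈ Finset.range n, w n i x • e i =
          ∑ i ∈ Finset.range n, w n i x • (f x - e i) + r n x • f x := by
        simp only [smul_sub, Finset.sum_sub_distrib, ← Finset.sum_smul, r, sub_smul, one_smul]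
        abel
      rw [e1]
      refine (norm_add_le _ _).trans (add_le_add ?_ ?_)
      · have h2 : ∀ i ∈ Finset.range n, ‖w n i x • (f x - e i)‖ ≤ w n i x * ε := by
          intro i _
          rw [norm_smul, Real.norm_of_nonneg (hw0 n i x)]
          by_cases hlt : ‖f x - e i‖ ≤ ε
          · exact mul_le_mul_of_nonneg_left hlt (hw0 n i x)
          · have : h i x = 0 := max_eq_left (by linarith [not_le.1 hlt])
            simp [w, this]
        refine (norm_sum_le_of_le _ h2).trans ?_
        rw [← Finset.sum_mul]
        have := hr0 n x
        simp only [r] at this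
        nlinarith
      · rw [norm_smul, Real.norm_of_nonneg (hr0 n x), mul_comm]
        exact mul_le_mul_of_nonneg_right (hC x) (hr0 n x)
    have hri := hii _ (hrc n) (hr0 n) (hr1 n) ν
    calc _ ≤ ∫ x, (ε + C * r n x) ∂(ν : Measure X) :=
          norm_integral_le_of_norm_le ((integrable_const _).add (hri.const_mul _))
            (ae_of_all _ hpt)
      _ = ε + C * ∫ x, r n x ∂(ν : Measure X) := by
          rw [integral_add (integrable_const _) (hri.const_mul _), integral_const_mul]
          simp
      _ ≤ ε + C * ε := by
          have : ∫ x, r n x ∂(ν : Measure X) < ε := hν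
          gcongr
      _ < (2 + C) * ε := by nlinarith
      _ = δ := by rw [hε]; field_simp

/-! ### Rank-one operators and continuous functionals on the trace class -/

noncomputable section

namespace QPM

variable {H : Type*} [NormedAddCommGroup H] [InnerProductSpace ℂ H] [CompleteSpace H]

/-- Cauchy–Schwarz over the basis, followed by Bessel's inequality for `star X x` and for `y`. -/
theorem eTraceNorm_rankOne_le (x y : H) :
    eTraceNorm (InnerProductSpace.rankOne ℂ x y) ≤ ENNReal.ofReal (‖x‖ * ‖y‖) := by
  refine eTraceNormWith_le _ _ _ fun X hX F => ?_
  have e : ∀ i, ‖⟪X (basis H i), InnerProductSpace.rankOne ℂ x y (basis H i)⟫_ℂ‖ =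
      ‖⟪basis H i, star X x⟫_ℂ‖ * ‖⟪basis H i, y⟫_ℂ‖ := by
    intro i
    rw [InnerProductSpace.rankOne_apply, inner_smul_right, norm_mul, mul_comm,
      norm_inner_symm y, ← inner_star_left, star_star]
  simp only [← ofReal_norm, e]
  rw [← ENNReal.ofReal_sum_of_nonneg fun i _ => by positivity]
  refine ENNReal.ofReal_le_ofReal (abs_le_of_sq_le_sq' ?_ (by positivity)).2
  refine (Finset.sum_mul_sq_le_sq_mul_sq F _ _).trans ?_
  rw [mul_pow]
  have h1 : ‖star X x‖ ≤ ‖x‖ := by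
    simpa using (star X).le_of_opNorm_le ((norm_star X).trans_le hX) x
  gcongr
  · exact ((basis H).orthonormal.sum_inner_products_le _).trans (by gcongr)
  · exact (basis H).orthonormal.sum_inner_products_le _

namespace TraceClass

/-- The trace-class operator `|x⟩⟨y|`. -/
def ketBra (x y : H) : TraceClass H :=
  ⟨InnerProductSpace.rankOne ℂ x y, (eTraceNorm_rankOne_le x y).trans_lt ENNReal.ofReal_lt_top⟩

@[simp] lemma op_ketBra (x y : H) : (ketBra x y).op = InnerProductSpace.rankOne ℂ x y := rfl

lemma norm_ketBra_le (x y : H) : ‖ketBra x y‖ ≤ ‖x‖ * ‖y‖ :=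
  ENNReal.toReal_le_of_le_ofReal (by positivity) (eTraceNorm_rankOne_le x y)

lemma continuous_ketBra_self : Continuous fun x : H => ketBra x x := by
  refine continuous_iff_continuousAt.2 fun x => tendsto_iff_norm_sub_tendsto_zero.2 ?_
  have h : ∀ y : H, ‖ketBra y y - ketBra x x‖ ≤ ‖y - x‖ * ‖y‖ + ‖x‖ * ‖y - x‖ := by
    intro y
    have e : ketBra y y - ketBra x x = ketBra (y - x) y + ketBra x (y - x) := by
      refine op_injective ?_
      simp
    rw [e]
    exact (norm_add_le _ _).trans (add_le_add (norm_ketBra_le _ _) (norm_ketBra_le _ _))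
  refine squeeze_zero (fun _ => norm_nonneg _) h ?_
  have : Continuous fun y : H => ‖y - x‖ * ‖y‖ + ‖x‖ * ‖y - x‖ := by fun_prop
  simpa using this.tendsto x

variable (H) in
/-- The inclusion of the trace-class operators into the bounded operators. -/
def opCLM : TraceClass H →L[ℂ] (H →L[ℂ] H) :=
  LinearMap.mkContinuous
    { toFun := op, map_add' := op_add, map_smul' := op_smul } 1
    fun A => by simpa using A.opNorm_le

@[simp] lemma opCLM_apply (A : TraceClass H) : opCLM H A = A.op := rfl

/-- The functional `A ↦ ⟨ψ, A ψ⟩`. -/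
def expectation (ψ : H) : TraceClass H →L[ℂ] ℂ :=
  (innerSL ℂ ψ).comp ((ContinuousLinearMap.apply ℂ H ψ).comp (opCLM H))

@[simp] lemma expectation_apply (ψ : H) (A : TraceClass H) :
    expectation ψ A = ⟪ψ, A.op ψ⟫_ℂ := rfl

lemma norm_sum_expectation_le (F : Finset (BasisIndex H)) (A : TraceClass H) :
    ‖∑ i ∈ F, expectation (basis H i) A‖ ≤ ‖A‖ := by
  refine (norm_sum_le _ _).trans ?_
  have h := ENNReal.toReal_mono A.eTraceNorm_lt_top.ne
    (sum_inner_le (basis H) (basis H) A.op 1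
      (ContinuousLinearMap.opNorm_le_bound _ zero_le_one fun x => by simp) F)
  rw [ENNReal.toReal_sum fun i _ => by simp] at h
  simpa [norm_def] using h

lemma hasSum_expectation (A : TraceClass H) :
    HasSum (fun i => expectation (basis H i) A) (trace A.op) :=
  (summable_trace (basis H) A.eTraceNorm_lt_top).hasSum

variable (H) in
/-- The trace as a continuous functional. -/
def traceCLM : TraceClass H →L[ℂ] ℂ :=
  LinearMap.mkContinuous
    { toFun := fun A => trace A.op
      map_add' := fun A B => (hasSum_expectation (A + B)).unique <| by
        simpa only [map_add] using (hasSum_expectation A).add (hasSum_expectation B)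
      map_smul' := fun z A => (hasSum_expectation (z • A)).unique <| by
        simpa only [map_smul] using! (hasSum_expectation A).const_smul z } 1
    fun A => by
      rw [one_mul]
      exact le_of_tendsto (hasSum_expectation A).norm
        (Filter.Eventually.of_forall fun F => norm_sum_expectation_le F A)

@[simp] lemma traceCLM_apply (A : TraceClass H) : traceCLM H A = trace A.op := rfl

lemma norm_trace_le (A : TraceClass H) : ‖trace A.op‖ ≤ ‖A‖ :=
  le_of_tendsto (hasSum_expectation A).norm
    (Filter.Eventually.of_forall fun F => norm_sum_expectation_le F A)

/-! ### Tails of the trace and compactness -/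

/-- The part of the trace outside a finite set of basis vectors. -/
def traceTail (F : Finset (BasisIndex H)) : TraceClass H →L[ℂ] ℂ :=
  traceCLM H - ∑ i ∈ F, expectation (basis H i)

lemma traceTail_apply (F : Finset (BasisIndex H)) (A : TraceClass H) :
    traceTail F A = trace A.op - ∑ i ∈ F, expectation (basis H i) A := by
  simp [traceTail]

lemma norm_traceTail_le (F : Finset (BasisIndex H)) (A : TraceClass H) :
    ‖traceTail F A‖ ≤ 2 * ‖A‖ := by
  rw [traceTail_apply, two_mul]
  exact (norm_sub_le _ _).trans (add_le_add (norm_trace_le A) (norm_sum_expectation_le F A))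

lemma tendsto_traceTail (A : TraceClass H) :
    Filter.Tendsto (fun F => traceTail F A) Filter.atTop (𝓝 0) := by
  have h : Filter.Tendsto (fun F => ∑ i ∈ F, expectation (basis H i) A) Filter.atTop
      (𝓝 (trace A.op)) := hasSum_expectation A
  simpa [traceTail_apply] using h.const_sub (trace A.op)

/-- The tails of the trace are uniformly small on compact sets. -/
lemma exists_traceTail_le {C : Set (TraceClass H)} (hC : IsCompact C) {ε : ℝ} (hε : 0 < ε) :
    ∃ F, ∀ A ∈ C, ‖traceTail F A‖ ≤ ε := by
  -- Tails are 2-Lipschitz uniformly in `F`, so pointwise convergence on a finite net suffices: `2 *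
  -- (ε / 4) + ε / 2 = ε`.
  obtain ⟨t, ht, hCt⟩ := Metric.totallyBounded_iff.1 hC.totallyBounded (ε / 4) (by positivity)
  have h : ∀ᶠ F in Filter.atTop, ∀ B ∈ t, ‖traceTail F B‖ < ε / 2 := by
    refine (Filter.eventually_all_finite ht).2 fun B _ => ?_
    have := (tendsto_traceTail B).norm
    rw [norm_zero] at this
    exact this.eventually_lt_const (by positivity)
  obtain ⟨F, hF⟩ := h.exists
  refine ⟨F, fun A hA => ?_⟩
  obtain ⟨B, hB, hAB⟩ := mem_iUnion₂.1 (hCt hA)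
  rw [Metric.mem_ball, dist_eq_norm] at hAB
  have e : traceTail F A = traceTail F (A - B) + traceTail F B := by simp
  rw [e]
  have h1 := norm_add_le (traceTail F (A - B)) (traceTail F B)
  have h2 := norm_traceTail_le F (A - B)
  have h3 := hF B hB
  linarith

lemma trace_ketBra (x y : H) : trace (ketBra x y).op = ⟪y, x⟫_ℂ := by
  refine (hasSum_expectation (ketBra x y)).unique ?_
  simpa [inner_smul_right] using (basis H).hasSum_inner_mul_inner y x

/-- The projection onto the span of finitely many vectors of the basis. -/
def truncate (F : Finset (BasisIndex H)) (ψ : H) : H := ∑ i ∈ F, ⟪basis H i, ψ⟫_ℂ • basis H i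

lemma continuous_truncate (F : Finset (BasisIndex H)) : Continuous (truncate F) := by
  unfold truncate
  fun_prop

/-- Pythagoras: the trace is `‖ψ‖ ^ 2` and the subtracted part is `‖truncate F ψ‖ ^ 2`. This is
where purity turns a linear functional of the state into a distance in `H`. -/
lemma traceTail_ketBra_self (F : Finset (BasisIndex H)) (ψ : H) :
    traceTail F (ketBra ψ ψ) = ((‖ψ - truncate F ψ‖ ^ 2 : ℝ) : ℂ) := by
  have h1 : ∀ i ∈ F, ⟪basis H i, ψ - truncate F ψ⟫_ℂ = 0 := by
    intro i hi
    rw [inner_sub_right, truncate, (basis H).orthonormal.inner_right_sum _ hi, sub_self]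
  have h2 : ⟪truncate F ψ, ψ - truncate F ψ⟫_ℂ = 0 := by
    nth_rewrite 1 [truncate]
    rw [sum_inner]
    refine Finset.sum_eq_zero fun i hi => ?_
    rw [inner_smul_left, h1 i hi, mul_zero]
  have h3 : ((‖ψ - truncate F ψ‖ ^ 2 : ℝ) : ℂ) = ⟪ψ, ψ - truncate F ψ⟫_ℂ := by
    have := inner_self_eq_norm_sq_to_K (𝕜 := ℂ) (ψ - truncate F ψ)
    rw [inner_sub_left, h2, sub_zero] at this
    rw [this]
    simp
  rw [h3, traceTail_apply, trace_ketBra, inner_sub_right, truncate, inner_sum]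
  simp [inner_smul_right, mul_comm]

/-- A set of vectors of the unit ball with uniformly small tails is compact. -/
lemma isCompact_setOf_norm_sub_truncate_le {F : ℕ → Finset (BasisIndex H)} {δ : ℕ → ℝ}
    (hδ : Filter.Tendsto δ Filter.atTop (𝓝 0)) :
    IsCompact {ψ : H | ‖ψ‖ ≤ 1 ∧ ∀ k, ‖ψ - truncate (F k) ψ‖ ^ 2 ≤ δ k} := by
  refine TotallyBounded.isCompact_of_isClosed ?_ ?_
  · refine Metric.totallyBounded_iff.2 fun ε hε => ?_
    obtain ⟨k, hk⟩ := (hδ.eventually_lt_const (show 0 < (ε / 2) ^ 2 by positivity)).exists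
    -- The truncations of unit-ball vectors lie in a finite-dimensional compact set, whose `ε /
    -- 2`-net is an `ε`-net for the vectors themselves.
    have hQ : IsCompact ((fun c : F k → ℂ => ∑ i, c i • basis H i) ''
        Metric.closedBall 0 1) :=
      (isCompact_closedBall _ _).image (by fun_prop)
    obtain ⟨t, ht, hQt⟩ := Metric.totallyBounded_iff.1 hQ.totallyBounded (ε / 2) (by positivity)
    refine ⟨t, ht, fun ψ hψ => ?_⟩
    have hmem : truncate (F k) ψ ∈ (fun c : F k → ℂ => ∑ i, c i • basis H i) ''
        Metric.closedBall 0 1 := by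
      refine ⟨fun i => ⟪basis H i, ψ⟫_ℂ, ?_, ?_⟩
      · rw [mem_closedBall_zero_iff, pi_norm_le_iff_of_nonneg zero_le_one]
        intro i
        refine (norm_inner_le_norm _ _).trans ?_
        rw [(basis H).orthonormal.1, one_mul]
        exact hψ.1
      · exact Finset.sum_coe_sort (F k) fun i => ⟪basis H i, ψ⟫_ℂ • basis H i
    obtain ⟨y, hy, hyψ⟩ := mem_iUnion₂.1 (hQt hmem)
    refine mem_iUnion₂.2 ⟨y, hy, ?_⟩
    have h1 : ‖ψ - truncate (F k) ψ‖ < ε / 2 :=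
      lt_of_pow_lt_pow_left₀ 2 (by positivity) ((hψ.2 k).trans_lt hk)
    rw [← dist_eq_norm] at h1
    rw [Metric.mem_ball] at hyψ ⊢
    linarith [dist_triangle ψ (truncate (F k) ψ) y]
  · simp only [ofPred_and, ofPred_forall]
    refine (isClosed_le continuous_norm continuous_const).inter (isClosed_iInter fun k => ?_)
    exact isClosed_le ((continuous_id.sub (continuous_truncate (F k))).norm.pow 2)
      continuous_const

/-! ### States and pure states -/

-- Positivity survives operator-norm limits, and the trace is continuous for the trace norm.
variable (H) in
lemma isClosed_stateSpace : IsClosed (stateSpace H) := by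
  have h1 : IsClosed {A : TraceClass H | A.op.IsPositive} := by
    simp only [← ContinuousLinearMap.nonneg_iff_isPositive]
    exact isClosed_Ici.preimage (opCLM H).continuous
  exact h1.inter (isClosed_eq (traceCLM H).continuous continuous_const)

end TraceClass

lemma IsPure.exists_eq_ketBra {A : TraceClass H} (hA : IsPure A) :
    ∃ ψ : H, ‖ψ‖ = 1 ∧ A = TraceClass.ketBra ψ ψ :=
  hA.imp fun _ h => ⟨h.1, TraceClass.op_injective h.2⟩

lemma IsPure.norm_le_one {A : TraceClass H} (hA : IsPure A) : ‖A‖ ≤ 1 := by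
  obtain ⟨ψ, hψ, rfl⟩ := hA.exists_eq_ketBra
  simpa [hψ] using TraceClass.norm_ketBra_le ψ ψ

lemma trace_mul_rankOne (A : TraceClass H) (ψ : H) :
    trace (A.op * InnerProductSpace.rankOne ℂ ψ ψ) = TraceClass.expectation ψ A := by
  have e : A.op * InnerProductSpace.rankOne ℂ ψ ψ = (TraceClass.ketBra (A.op ψ) ψ).op := by
    ext x
    simp
  rw [e, TraceClass.trace_ketBra, TraceClass.expectation_apply]

open TraceClass

/-- This supplies strong measurability with no separability assumption on `X`. -/
theorem isSeparable_range_of_isPure [TopologicalSpace.SeparableSpace H]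
    {X : Type*} {Φ : X → TraceClass H} (hpure : ∀ x, IsPure (Φ x)) :
    TopologicalSpace.IsSeparable (range Φ) := by
  refine (TopologicalSpace.isSeparable_range (continuous_ketBra_self (H := H))).mono ?_
  rintro _ ⟨x, rfl⟩
  obtain ⟨ψ, -, h⟩ := (hpure x).exists_eq_ketBra
  exact ⟨ψ, h.symm⟩

/-! ### Integrability, tightness and properness -/

section Barycenter

variable {X : Type*} [TopologicalSpace X] [MeasurableSpace X] [BorelSpace X]
  {Φ : X → TraceClass H}

theorem integrable_of_isPure [TopologicalSpace.SeparableSpace H]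
    (hpure : ∀ x, IsPure (Φ x)) (hΦ : Continuous Φ) (μ : ProbabilityMeasure X) :
    Integrable Φ (μ : Measure X) := by
  borelize (TraceClass H)
  exact Integrable.of_bound (stronglyMeasurable_iff_measurable_separable.2
    ⟨hΦ.measurable, isSeparable_range_of_isPure hpure⟩).aestronglyMeasurable 1
    (ae_of_all _ fun x => (hpure x).norm_le_one)

/-- The tail of the barycenter is the mean of the tails, so a barycenter with small tails forces
most pure states to have small tails; such states form a compact set. -/
theorem isTightMeasureSet_of_integral_mem_isCompact [TopologicalSpace.SeparableSpace H]
    (hpure : ∀ x, IsPure (Φ x)) (hΦ : IsClosedEmbedding Φ) {C : Set (TraceClass H)}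
    (hC : IsCompact C) {S : Set (ProbabilityMeasure X)}
    (hS : ∀ μ ∈ S, ∫ x, Φ x ∂(μ : Measure X) ∈ C) :
    IsTightMeasureSet {((μ : ProbabilityMeasure X) : Measure X) | μ ∈ S} := by
  -- The choice of `ψ` need not be measurable: it is integrated only through `traceTail (F k) (Φ
  -- x)`, which is continuous in `x`.
  choose ψ hψ hψΦ using fun x => (hpure x).exists_eq_ketBra
  rw [isTightMeasureSet_iff_exists_isCompact_measure_compl_le]
  intro ε hε
  obtain ⟨η, hη, hηε⟩ := ENNReal.exists_pos_sum_of_countable hε.ne' ℕ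
  let δ : ℕ → ℝ := fun k => 1 / ((k : ℝ) + 1)
  have hδ : ∀ k, 0 < δ k := fun k => by positivity
  -- Markov's inequality at level `δ k` divides this tolerance by `δ k`, leaving the summable bound
  -- `η k`.
  choose F hF using fun k => exists_traceTail_le hC (mul_pos (hδ k) (NNReal.coe_pos.2 (hη k)))
  have htail : ∀ k x, (traceTail (F k) (Φ x)).re = ‖ψ x - truncate (F k) (ψ x)‖ ^ 2 :=
    fun k x => by rw [hψΦ x, traceTail_ketBra_self, Complex.ofReal_re]
  refine ⟨Φ ⁻¹' ((fun v : H => ketBra v v) ''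
      {v | ‖v‖ ≤ 1 ∧ ∀ k, ‖v - truncate (F k) v‖ ^ 2 ≤ δ k}),
    hΦ.isCompact_preimage ((isCompact_setOf_norm_sub_truncate_le
      tendsto_one_div_add_atTop_nhds_zero_nat).image continuous_ketBra_self), ?_⟩
  rintro _ ⟨μ, hμ, rfl⟩
  have hsub : (Φ ⁻¹' ((fun v : H => ketBra v v) ''
      {v | ‖v‖ ≤ 1 ∧ ∀ k, ‖v - truncate (F k) v‖ ^ 2 ≤ δ k}))ᶜ ⊆
      ⋃ k, {x | δ k ≤ (traceTail (F k) (Φ x)).re} := by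
    intro x hx
    by_contra hcon
    refine hx ⟨ψ x, ⟨(hψ x).le, fun k => ?_⟩, (hψΦ x).symm⟩
    by_contra hk
    refine hcon (mem_iUnion.2 ⟨k, ?_⟩)
    change δ k ≤ _
    rw [htail]
    exact (not_le.1 hk).le
  have hk : ∀ k, (μ : Measure X) {x | δ k ≤ (traceTail (F k) (Φ x)).re} ≤ η k := by
    intro k
    have hint := integrable_of_isPure hpure hΦ.continuous μ
    have hcomm : ∫ x, traceTail (F k) (Φ x) ∂(μ : Measure X) =
        traceTail (F k) (∫ x, Φ x ∂(μ : Measure X)) :=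
      (traceTail (F k)).integral_comp_comm hint
    have hre : ∫ x, (traceTail (F k) (Φ x)).re ∂(μ : Measure X) =
        (∫ x, traceTail (F k) (Φ x) ∂(μ : Measure X)).re :=
      integral_re ((traceTail (F k)).integrable_comp hint)
    have h1 := mul_meas_ge_le_integral_of_nonneg (μ := (μ : Measure X))
      (f := fun x => (traceTail (F k) (Φ x)).re)
      (ae_of_all _ fun x => by simp only [htail]; positivity)
      ((traceTail (F k)).integrable_comp hint).re (δ k)
    rw [hre, hcomm] at h1
    have h2 := h1.trans ((Complex.re_le_norm _).trans (hF k _ (hS μ hμ)))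
    have h3 := le_of_mul_le_mul_left h2 (hδ k)
    rw [← ENNReal.ofReal_coe_nnreal]
    exact (ENNReal.le_ofReal_iff_toReal_le (measure_ne_top _ _) (η k).coe_nonneg).2 h3
  exact (measure_mono hsub).trans ((measure_iUnion_le _).trans
    ((ENNReal.tsum_le_tsum hk).trans hηε.le))

theorem continuous_integral_of_isPure [TopologicalSpace.SeparableSpace H]
    (hpure : ∀ x, IsPure (Φ x)) (hΦ : Continuous Φ) :
    Continuous fun μ : ProbabilityMeasure X => ∫ x, Φ x ∂(μ : Measure X) :=
  continuous_integral_of_isSeparable_range hΦ (isSeparable_range_of_isPure hpure)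
    (fun x => (hpure x).norm_le_one) (integrable_of_isPure hpure hΦ)

theorem isProperMap_integral_of_isPure [TopologicalSpace.SeparableSpace H]
    (hpure : ∀ x, IsPure (Φ x)) (hΦ : IsClosedEmbedding Φ) :
    IsProperMap fun μ : ProbabilityMeasure X => ∫ x, Φ x ∂(μ : Measure X) := by
  have : T2Space X := hΦ.isEmbedding.t2Space
  have hcont := continuous_integral_of_isPure hpure hΦ.continuous
  refine isProperMap_iff_isCompact_preimage.2 ⟨hcont, fun C hC => ?_⟩
  -- Prokhorov's theorem; the preimage is already closed by continuity.
  have h := isCompact_closure_of_isTightMeasureSet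
    (isTightMeasureSet_of_integral_mem_isCompact hpure hΦ hC
      (S := (fun μ : ProbabilityMeasure X => ∫ x, Φ x ∂(μ : Measure X)) ⁻¹' C) fun μ hμ => hμ)
  rwa [(hC.isClosed.preimage hcont).closure_eq] at h

end Barycenter

/-! ### Closed convex hulls and complete metrization -/

/-- The set of Bochner integrals of a function against all probability measures is convex. -/
theorem convex_range_integral {X E : Type*} [MeasurableSpace X] [NormedAddCommGroup E]
    [NormedSpace ℝ E] {f : X → E}
    (hint : ∀ μ : ProbabilityMeasure X, Integrable f (μ : Measure X)) :
    Convex ℝ (range fun μ : ProbabilityMeasure X => ∫ x, f x ∂(μ : Measure X)) := by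
  rintro _ ⟨μ, rfl⟩ _ ⟨ν, rfl⟩ a b ha hb hab
  have hp : IsProbabilityMeasure
      (ENNReal.ofReal a • (μ : Measure X) + ENNReal.ofReal b • (ν : Measure X)) := by
    refine ⟨?_⟩
    simp [← ENNReal.ofReal_add ha hb, hab]
  refine ⟨⟨_, hp⟩, ?_⟩
  simp only [ProbabilityMeasure.coe_mk]
  rw [integral_add_measure ((hint μ).smul_measure ENNReal.ofReal_ne_top)
    ((hint ν).smul_measure ENNReal.ofReal_ne_top), integral_smul_measure, integral_smul_measure,
    ENNReal.toReal_ofReal ha, ENNReal.toReal_ofReal hb]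

theorem range_integral_eq_closedConvexHull {X E : Type*} [MeasurableSpace X]
    [NormedAddCommGroup E] [NormedSpace ℝ E] [CompleteSpace E] {f : X → E}
    (hf : StronglyMeasurable f)
    (hint : ∀ μ : ProbabilityMeasure X, Integrable f (μ : Measure X))
    (hclosed : IsClosed (range fun μ : ProbabilityMeasure X => ∫ x, f x ∂(μ : Measure X))) :
    (range fun μ : ProbabilityMeasure X => ∫ x, f x ∂(μ : Measure X)) =
      closedConvexHull ℝ (range f) := by
  refine Subset.antisymm ?_ (closedConvexHull_min ?_ (convex_range_integral hint) hclosed)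
  · rintro _ ⟨μ, rfl⟩
    exact convex_closedConvexHull.integral_mem isClosed_closedConvexHull
      (ae_of_all _ fun x => subset_closedConvexHull (mem_range_self x)) (hint μ)
  · rintro _ ⟨x, rfl⟩
    -- Strong measurability of `f` is used because singletons of `X` need not be measurable.
    exact ⟨⟨Measure.dirac x, inferInstance⟩, integral_dirac' f x hf⟩

theorem completelyMetrizes_of_isClosedEmbedding {P E : Type*} [t : TopologicalSpace P]
    [MetricSpace E] [CompleteSpace E] {g : P → E} (hg : IsClosedEmbedding g) :
    CompletelyMetrizes fun p q => dist (g p) (g q) := by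
  let m : MetricSpace P := MetricSpace.induced g hg.injective inferInstance
  refine ⟨m, fun _ _ => rfl, hg.isInducing.eq_induced.symm, ?_⟩
  have hu : IsUniformInducing g := ⟨rfl⟩
  exact (completeSpace_iff_isComplete_range hu).2 hg.isClosed_range.isComplete

end QPM

end

/-! ### The main theorem -/

theorem theorem3 {H : Type*} [NormedAddCommGroup H] [InnerProductSpace ℂ H] [CompleteSpace H]
    [TopologicalSpace.SeparableSpace H]
    {X : Type*} [TopologicalSpace X] [MeasurableSpace X] [BorelSpace X]
    (φ : X → QPM.stateSpace H)
    (hpure : ∀ x, QPM.IsPure (φ x : QPM.TraceClass H))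
    (hclosed : IsClosedEmbedding φ)
    (hchar : QPM.IsCharacteristic (QPM.kernel φ)) :
    (∀ μ : ProbabilityMeasure X,
      Integrable (fun x => (φ x : QPM.TraceClass H)) (μ : Measure X)) ∧
    (∃ h : ProbabilityMeasure X ≃ₜ
        (closedConvexHull ℝ (range fun x => (φ x : QPM.TraceClass H)) :
          Set (QPM.TraceClass H)),
      ∀ μ, (h μ : QPM.TraceClass H) = QPM.barycenter φ μ) ∧
    QPM.CompletelyMetrizes fun μ ν : ProbabilityMeasure X =>
      QPM.traceDist (QPM.barycenter φ μ) (QPM.barycenter φ ν) := by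
  -- Closedness in the state space passes to the whole trace class because the state space is itself
  -- closed.
  have hΦ : IsClosedEmbedding fun x => (φ x : QPM.TraceClass H) :=
    (QPM.TraceClass.isClosed_stateSpace H).isClosedEmbedding_subtypeVal.comp hclosed
  have hint := QPM.integrable_of_isPure hpure hΦ.continuous
  have hproper : IsProperMap (QPM.barycenter φ) := QPM.isProperMap_integral_of_isPure hpure hΦ
  have hinj : Function.Injective (QPM.barycenter φ) := by
    intro μ ν hμν
    refine hchar (funext fun y => ?_)
    obtain ⟨ψ, -, hψ⟩ := hpure y
    -- With `ρ_y = |ψ⟩⟨ψ|` the kernel is `⟨ψ, ρ_x ψ⟩`, continuous and linear in `ρ_x`, hence it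
    -- commutes with the integral.
    have key : ∀ μ : ProbabilityMeasure X, ∫ x, QPM.kernel φ x y ∂(μ : Measure X) =
        QPM.TraceClass.expectation ψ (QPM.barycenter φ μ) := by
      intro μ
      simp only [QPM.kernel, hψ, QPM.trace_mul_rankOne]
      exact (QPM.TraceClass.expectation ψ).integral_comp_comm (hint μ)
    simp only [key, hμν]
  have hemb : IsClosedEmbedding (QPM.barycenter φ) :=
    .of_continuous_injective_isClosedMap hproper.continuous hinj hproper.isClosedMap
  have hrange : range (QPM.barycenter φ) =
      closedConvexHull ℝ (range fun x => (φ x : QPM.TraceClass H)) := by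
    borelize (QPM.TraceClass H)
    exact QPM.range_integral_eq_closedConvexHull (stronglyMeasurable_iff_measurable_separable.2
      ⟨hΦ.continuous.measurable, QPM.isSeparable_range_of_isPure hpure⟩) hint
      hemb.isClosed_range
  refine ⟨hint, ⟨hemb.isEmbedding.toHomeomorph.trans (Homeomorph.setCongr hrange),
    fun μ => rfl⟩, ?_⟩
  -- The factor `1 / 2` of the trace distance is absorbed into the embedding.
  have hhalf := (Homeomorph.smulOfNeZero (α := QPM.TraceClass H) (1 / 2 : ℝ)
    (by norm_num)).isClosedEmbedding.comp hemb
  convert QPM.completelyMetrizes_of_isClosedEmbedding hhalf using 3 with μ ν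
  simp [QPM.traceDist, dist_eq_norm, ← smul_sub, norm_smul]
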